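/- Let $p\ge 1$ be a real number. For a finitely generated group $H$ with a finite generating set $S$, let $d$ be the word length distance $d(g,h)=|g^{-1}h|_S$. A map $f\colon H\to L_p(\Omega,\mu)$, with $(\Omega,\mu)$ a measure space, is a *coarse embedding* if there are a non-decreasing function $\rho\colon[0,\infty)\to[0,\infty)$ with $\lim_{t\to\infty}\rho(t)=\infty$ and a constant $C>0$ such that $\rho(d(g,h))\le\|f(g)-f(h)\|_p\le C\,d(g,h)$ for all $g,h\in H$. It is *$H$-equivariant* if there is an affine isometric action $\alpha$ of $H$ on $L_p(\Omega,\mu)$ with $f(gh)=\alpha(g)(f(h))$ for all $g,h\in H$. For a coarse embedding $f$, let $R(f)$ be the supremum of all $r\in[0,1]$ for which there are $C,D>0$ with $$\tfrac1C\,d(g,h)^r-D\le\|f(g)-f(h)\|_p\le C\,d(g,h)\qquad\text{for all } g,h\in H.$$ The *equivariant $L_p$-compression* $\alpha_p^*(H)$ is the supremum of $R(f)$ over all $H$-equivariant coarse embeddings $f$ of $H$ into $L_p$-spaces, and it is $0$ if there are none. (Scalars are $\mathbb R$ throughout or $\mathbb C$ throughout.) Let $\Gamma$ be a finite simplicial graph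 with vertex set $V\Gamma$, let $\mathfrak G=\{G_v\mid v\in V\Gamma\}$ be a collection of finitely generated groups, and let $G=\Gamma\mathfrak G$ be their graph product, i.e. the quotient of the free product of the groups $G_v$ by the relations $[g,h]=1$ for all $g\in G_v$, $h\in G_u$ with $\{v,u\}$ an edge of $\Gamma$. Then $G$ is finitely generated and $$\alpha_p^*(G)\ \ge\ \min\{1/p,\ \alpha_p^*(G_v)\mid v\in V\Gamma\},$$ where the compressions are computed with any finite generating sets of $G$ and of the groups $G_v$. -/

import Mathlib

open MeasureTheory Filter
open scoped NNReal ENNReal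

universe w u v k

section GraphProducts

variable {V : Type v} (Γ : SimpleGraph V) (G : V → Type u) [∀ a, Group (G a)]

/-- The words `[g, h] = g⁻¹ h⁻¹ g h` in the free product of the vertex groups, where `g` and `h`
lie in vertex groups whose vertices are joined by an edge of `Γ`. -/
def graphProductRelators : Set (Monoid.CoprodI G) :=
  {x | ∃ a b : V, Γ.Adj a b ∧ ∃ (g : G a) (h : G b),
    x = (Monoid.CoprodI.of g)⁻¹ * (Monoid.CoprodI.of h)⁻¹ *
      Monoid.CoprodI.of g * Monoid.CoprodI.of h}

/-- The graph product of the groups `G a`, for `a` a vertex of `Γ`: the free product of the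
vertex groups modulo the relations saying that adjacent vertex groups commute. -/
def GraphProduct : Type (max u v) :=
  Monoid.CoprodI G ⧸ Subgroup.normalClosure (graphProductRelators Γ G)

instance GraphProduct.instGroup : Group (GraphProduct Γ G) :=
  inferInstanceAs (Group (Monoid.CoprodI G ⧸ Subgroup.normalClosure (graphProductRelators Γ G)))

end GraphProducts

noncomputable section Compression

/-- Word length of `g` with respect to `S`: the least length of a product of elements of `S` and
their inverses that equals `g` (for `S` a generating set). -/
def wordLength {G : Type u} [Group G] (S : Set G) (g : G) : ℕ :=
  sInf {n | ∃ l : List G, l.length = n ∧ (∀ x ∈ l, x ∈ S ∨ x⁻¹ ∈ S) ∧ l.prod = g}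

/-- The (left-invariant) word length distance with respect to `S`. -/
def wordDist {G : Type u} [Group G] (S : Set G) (g h : G) : ℕ :=
  wordLength S (g⁻¹ * h)

/-- `f` is a coarse embedding of `G`, with the word length distance given by `S`, into a normed
space. -/
def IsCoarseEmbedding {G : Type u} [Group G] (S : Set G)
    {E : Type w} [NormedAddCommGroup E] (f : G → E) : Prop :=
  ∃ (ρ : ℝ≥0 → ℝ≥0) (C : ℝ), Monotone ρ ∧ Tendsto ρ atTop atTop ∧ 0 < C ∧
    ∀ g h : G, (ρ (wordDist S g h) : ℝ) ≤ ‖f g - f h‖ ∧ ‖f g - f h‖ ≤ C * wordDist S g h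

/-- `f : G → E` is `G`-equivariant: `f (g h) = α(g) (f h)` for some affine isometric action `α`
of `G` on `E` (the group structure on affine isometries is composition). -/
def IsAffineEquivariant (𝕜 : Type k) [RCLike 𝕜] {G : Type u} [Group G]
    {E : Type w} [NormedAddCommGroup E] [NormedSpace 𝕜 E] (f : G → E) : Prop :=
  ∃ α : G →* (E ≃ᵃⁱ[𝕜] E), ∀ g h : G, f (g * h) = α g (f h)

/-- The compression `R(f)` of a map `f` from `G`, with the word length distance given by `S`, to a
normed space. -/
def compression {G : Type u} [Group G] (S : Set G)
    {E : Type w} [NormedAddCommGroup E] (f : G → E) : ℝ :=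
  sSup {r : ℝ | 0 ≤ r ∧ r ≤ 1 ∧ ∃ C D : ℝ, 0 < C ∧ 0 < D ∧ ∀ g h : G,
    1 / C * (wordDist S g h : ℝ) ^ r - D ≤ ‖f g - f h‖ ∧ ‖f g - f h‖ ≤ C * wordDist S g h}

/-- The equivariant `L_p`-compression of `G`, computed with the finite generating set `S`: the
supremum of `R(f)` over all `G`-equivariant coarse embeddings `f` of `G` into spaces
`L_p(Ω, μ)` of `𝕜`-valued functions, with `(Ω, μ)` any measure space. It is `0` if there is no
such `f`, since the supremum of the empty set of reals is `0`. -/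
def equivariantCompression (𝕜 : Type k) [RCLike 𝕜] (p : ℝ≥0∞) [Fact (1 ≤ p)]
    {G : Type u} [Group G] (S : Set G) : ℝ :=
  sSup {x : ℝ | ∃ (Ω : Type w) (_ : MeasurableSpace Ω) (μ : Measure Ω) (f : G → Lp 𝕜 p μ),
    IsCoarseEmbedding S f ∧ IsAffineEquivariant 𝕜 f ∧ x = compression S f}

end Compression

/-! Call ψ an `Lp`-length if ψ = ‖b‖^p for a cocycle b of a linear isometric representation on an
`Lp`-space. Sums of `Lp`-lengths are `Lp`-lengths, since ℓp-sums of `Lp`-spaces are `Lp`-spaces.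
Every positive r below the compression of a vertex group gives an `Lp`-length ψ_v ≥ c|·|^(rp) on it;
conversely such a length on the graph product bounds its compression below by r. So it suffices to
find an `Lp`-length Ψ on the graph product that adds up the ψ_v over the syllables of a shortest
syllable expression. For rp ≤ 1 the function t^(rp) is subadditive, whence Ψ ≥ c|·|^(rp); this is
the role of 1/p.

Ψ arises by inducing cocycles. Let σ(x) in G_v be the syllable of x that can be shuffled to the
front (`firstSyllable`). The map σ is equivariant under left translation by a subgroup `star`
containing G_v and its link. The induced cocycle lives on the ℓp-sum over the cosets of `star`, and
contributes ψ_v(σ(x⁻¹)⁻¹ σ(x⁻¹g)) at the coset of x. Its support is finite because right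
multiplication by an element of G_v changes σ(x) only when x lies in G_v·link
(`firstSyllable_mul_of`). Additivity over syllables is `tsum_disp_of_mul`, and `le_tsum_disp` draws
the lower bound.

The map σ is read off from an embedding of the graph product into a free product of copies of G_v
extended by a permutation action, so only normal forms in free products are needed. -/

/-! ### Disjoint unions of measure spaces and ℓp-sums. -/

section SigmaLp

variable {J : Type*} {Ω : J → Type*} [∀ j, MeasurableSpace (Ω j)]

/-- The disjoint union of a family of measures. -/
noncomputable def sigmaMeasure (μ : ∀ j, Measure (Ω j)) : Measure (Σ j, Ω j) :=
  Measure.sum fun j => (μ j).map (Sigma.mk j)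

theorem measurable_sigmaMk (j : J) : Measurable (Sigma.mk j : Ω j → Σ j, Ω j) :=
  measurable_iff_comap_le.2 (MeasurableSpace.comap_le_iff_le_map.2 (iInf_le _ j))

theorem measurable_sigma_of_comp {α : Type*} [MeasurableSpace α] {f : (Σ j, Ω j) → α}
    (hf : ∀ j, Measurable fun x => f ⟨j, x⟩) : Measurable f := by
  intro s hs
  rw [MeasurableSpace.measurableSet_iInf]
  exact fun j => hf j hs

variable {μ : ∀ j, Measure (Ω j)}

theorem map_sigmaMk_le (j : J) : (μ j).map (Sigma.mk j) ≤ sigmaMeasure μ :=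
  Measure.le_sum (fun j => (μ j).map (Sigma.mk j)) j

variable {𝕜 : Type*} [RCLike 𝕜] {p : ℝ≥0∞}

theorem MeasureTheory.MemLp.comp_sigmaMk {f : (Σ j, Ω j) → 𝕜} (hf : MemLp f p (sigmaMeasure μ))
    (j : J) : MemLp (fun x => f ⟨j, x⟩) p (μ j) :=
  (hf.mono_measure (map_sigmaMk_le j)).comp_of_map (measurable_sigmaMk j).aemeasurable

theorem ae_comp_sigmaMk {P : (Σ j, Ω j) → Prop} (h : ∀ᵐ x ∂sigmaMeasure μ, P x) (j : J) :
    ∀ᵐ x ∂μ j, P ⟨j, x⟩ :=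
  ae_of_ae_map (measurable_sigmaMk j).aemeasurable
    ((Measure.absolutelyContinuous_of_le (map_sigmaMk_le j)).ae_le h)

theorem eLpNorm_sigma_rpow (hp0 : p ≠ 0) (hp : p ≠ ∞) {f : (Σ j, Ω j) → 𝕜} (hf : Measurable f) :
    eLpNorm f p (sigmaMeasure μ) ^ p.toReal =
      ∑' j, eLpNorm (fun x => f ⟨j, x⟩) p (μ j) ^ p.toReal := by
  have hpos := ENNReal.toReal_pos hp0 hp
  simp_rw [eLpNorm_eq_lintegral_rpow_enorm_toReal hp0 hp, one_div,
    ENNReal.rpow_inv_rpow hpos.ne']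
  rw [sigmaMeasure, lintegral_sum_measure]
  congr 1 with j
  rw [lintegral_map (by fun_prop) (measurable_sigmaMk j)]

theorem Lp_norm_rpow {Ω : Type*} [MeasurableSpace Ω] {μ : Measure Ω} (f : Lp 𝕜 p μ) :
    ‖f‖ ^ p.toReal = (eLpNorm f p μ ^ p.toReal).toReal := by
  rw [Lp.norm_def, ENNReal.toReal_rpow]

/-- Restricting a `p`-integrable function on a disjoint union to the pieces. -/
noncomputable def sigmaRestrict (j : J) (f : Lp 𝕜 p (sigmaMeasure μ)) : Lp 𝕜 p (μ j) :=
  ((Lp.memLp f).comp_sigmaMk j).toLp _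

theorem sigmaRestrict_ae (j : J) (f : Lp 𝕜 p (sigmaMeasure μ)) :
    sigmaRestrict j f =ᵐ[μ j] fun x => f ⟨j, x⟩ :=
  MemLp.coeFn_toLp _

theorem norm_rpow_eq_tsum_sigmaRestrict [hp1 : Fact (1 ≤ p)] (hp : p ≠ ∞) (f : Lp 𝕜 p (sigmaMeasure μ)) :
    Summable (fun j => ‖sigmaRestrict j f‖ ^ p.toReal) ∧
      ‖f‖ ^ p.toReal = ∑' j, ‖sigmaRestrict j f‖ ^ p.toReal := by
  have hp0 : p ≠ 0 := (zero_lt_one.trans_le hp1.out).ne'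
  have hf := eLpNorm_sigma_rpow (μ := μ) hp0 hp (Lp.stronglyMeasurable f).measurable
  have htop : eLpNorm f p (sigmaMeasure μ) ^ p.toReal ≠ ∞ :=
    ENNReal.rpow_ne_top_of_nonneg ENNReal.toReal_nonneg (Lp.eLpNorm_ne_top f)
  simp_rw [Lp_norm_rpow, eLpNorm_congr_ae (sigmaRestrict_ae _ f)]
  rw [hf] at htop ⊢
  exact ⟨ENNReal.summable_toReal htop,
    ENNReal.tsum_toReal_eq fun j => ENNReal.ne_top_of_tsum_ne_top htop j⟩

/-- `Lp` of a disjoint union is the `ℓp`-sum of the `Lp`s of the pieces. -/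
noncomputable def sigmaLpEquiv [hp1 : Fact (1 ≤ p)] (μ : ∀ j, Measure (Ω j)) (hp : p ≠ ∞) :
    Lp 𝕜 p (sigmaMeasure μ) ≃ₗᵢ[𝕜] lp (fun j => Lp 𝕜 p (μ j)) p := by
  have hp0 : p ≠ 0 := (zero_lt_one.trans_le hp1.out).ne'
  have hpos := ENNReal.toReal_pos hp0 hp
  refine LinearIsometryEquiv.ofSurjective (⟨⟨⟨fun f => ⟨fun j => sigmaRestrict j f,
    memℓp_gen (norm_rpow_eq_tsum_sigmaRestrict hp f).1⟩, ?_⟩, ?_⟩, ?_⟩ :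
      Lp 𝕜 p (sigmaMeasure μ) →ₗᵢ[𝕜] lp (fun j => Lp 𝕜 p (μ j)) p) ?_
  · intro f g
    refine lp.ext (funext fun j => Lp.ext ?_)
    change sigmaRestrict j (f + g) =ᵐ[μ j] (sigmaRestrict j f + sigmaRestrict j g : Lp 𝕜 p (μ j))
    filter_upwards [sigmaRestrict_ae j (f + g), sigmaRestrict_ae j f, sigmaRestrict_ae j g,
      Lp.coeFn_add (sigmaRestrict j f) (sigmaRestrict j g),
      ae_comp_sigmaMk (Lp.coeFn_add f g) j] with x h1 h2 h3 h4 h5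
    rw [h1, h4, h5, Pi.add_apply, Pi.add_apply, h2, h3]
  · intro c f
    refine lp.ext (funext fun j => Lp.ext ?_)
    change sigmaRestrict j (c • f) =ᵐ[μ j] (c • sigmaRestrict j f : Lp 𝕜 p (μ j))
    filter_upwards [sigmaRestrict_ae j (c • f), sigmaRestrict_ae j f,
      Lp.coeFn_smul c (sigmaRestrict j f), ae_comp_sigmaMk (Lp.coeFn_smul c f) j] with x h1 h2 h3 h4
    rw [h1, h3, h4, Pi.smul_apply, Pi.smul_apply, h2]
  · intro f
    refine (Real.rpow_left_inj (norm_nonneg _) (norm_nonneg _) hpos.ne').1 ?_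
    rw [lp.norm_rpow_eq_tsum hpos]
    exact (norm_rpow_eq_tsum_sigmaRestrict hp f).2.symm
  · intro ξ
    have hm : Measurable fun x : Σ j, Ω j => ξ x.1 x.2 :=
      measurable_sigma_of_comp fun j => (Lp.stronglyMeasurable (ξ j)).measurable
    have hmem : MemLp (fun x : Σ j, Ω j => ξ x.1 x.2) p (sigmaMeasure μ) := by
      refine ⟨hm.aestronglyMeasurable, ?_⟩
      rw [← ENNReal.rpow_lt_top_iff_of_pos hpos, eLpNorm_sigma_rpow hp0 hp hm, lt_top_iff_ne_top]
      have hξ : ∀ j, eLpNorm (fun x => ξ j x) p (μ j) ^ p.toReal =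
          ENNReal.ofReal (‖ξ j‖ ^ p.toReal) := fun j => by
        rw [Lp_norm_rpow, ENNReal.ofReal_toReal]
        exact ENNReal.rpow_ne_top_of_nonneg ENNReal.toReal_nonneg (Lp.eLpNorm_ne_top _)
      simp_rw [hξ]
      exact ((lp.memℓp ξ).summable hpos).tsum_ofReal_ne_top
    refine ⟨hmem.toLp, lp.ext (funext fun j => Lp.ext ?_)⟩
    change sigmaRestrict j hmem.toLp =ᵐ[μ j] ξ j
    filter_upwards [sigmaRestrict_ae j hmem.toLp, ae_comp_sigmaMk hmem.coeFn_toLp j] with x h1 h2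
    rw [h1, h2]

end SigmaLp

/-! ### Isometries of ℓp-sums that permute the summands. -/

section Reindex

variable {K J : Type*} {F : K → Type*} {E : J → Type*} [∀ j, NormedAddCommGroup (E j)]
  [∀ j, NormedAddCommGroup (F j)] {𝕜 : Type*} [RCLike 𝕜] [∀ j, NormedSpace 𝕜 (E j)]
  [∀ j, NormedSpace 𝕜 (F j)] {p : ℝ≥0∞} [hp1 : Fact (1 ≤ p)]

/-- Isometries between the summands of two `ℓp`-sums, matched by a bijection of the index sets,
give an isometry of the sums. -/
noncomputable def lpReindex (hp : p ≠ ∞) (e : K ≃ J) (Φ : ∀ k, E (e k) ≃ₗᵢ[𝕜] F k) :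
    lp E p ≃ₗᵢ[𝕜] lp F p := by
  have hp0 : p ≠ 0 := (zero_lt_one.trans_le hp1.out).ne'
  have hpos := ENNReal.toReal_pos hp0 hp
  refine LinearIsometryEquiv.ofSurjective (⟨⟨⟨fun ξ => ⟨fun k => Φ k (ξ (e k)),
    memℓp_gen ?_⟩, ?_⟩, ?_⟩, ?_⟩ : lp E p →ₗᵢ[𝕜] lp F p) ?_
  · simp_rw [LinearIsometryEquiv.norm_map]
    exact e.summable_iff.2 ((lp.memℓp ξ).summable hpos)
  · intro ξ η
    exact lp.ext (funext fun k => (Φ k).map_add _ _)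
  · intro c ξ
    exact lp.ext (funext fun k => (Φ k).map_smul _ _)
  · intro ξ
    refine (Real.rpow_left_inj (norm_nonneg _) (norm_nonneg _) hpos.ne').1 ?_
    rw [lp.norm_rpow_eq_tsum hpos, lp.norm_rpow_eq_tsum hpos]
    change ∑' k, ‖Φ k (ξ (e k))‖ ^ p.toReal = _
    simp_rw [LinearIsometryEquiv.norm_map]
    exact e.tsum_eq fun j => ‖ξ j‖ ^ p.toReal
  · intro η
    have h : ∀ k, Equiv.piCongrLeft E e (fun k => (Φ k).symm (η k)) (e k) = (Φ k).symm (η k) :=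
      fun k => Equiv.piCongrLeft_apply_apply E e _ k
    refine ⟨⟨Equiv.piCongrLeft E e fun k => (Φ k).symm (η k), memℓp_gen ?_⟩,
      lp.ext (funext fun k => ?_)⟩
    · rw [← e.summable_iff]
      refine ((lp.memℓp η).summable hpos).congr fun k => ?_
      simp [h]
    · change Φ k (Equiv.piCongrLeft E e (fun k => (Φ k).symm (η k)) (e k)) = _
      rw [h, LinearIsometryEquiv.apply_symm_apply]

@[simp]
theorem lpReindex_apply (hp : p ≠ ∞) (e : K ≃ J) (Φ : ∀ k, E (e k) ≃ₗᵢ[𝕜] F k) (ξ : lp E p)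
    (k : K) : lpReindex hp e Φ ξ k = Φ k (ξ (e k)) := rfl

end Reindex

/-! ### Cocycles and affine isometric actions. -/

section Cocycles

variable {𝕜 : Type*} [RCLike 𝕜] {H : Type*} [Group H]

/-- `b` is a cocycle for the linear isometric representation `π`. -/
def IsIsometryCocycle {E : Type*} [NormedAddCommGroup E] [NormedSpace 𝕜 E]
    (π : H →* (E ≃ₗᵢ[𝕜] E)) (b : H → E) : Prop :=
  ∀ g h, b (g * h) = b g + π g (b h)

namespace IsIsometryCocycle

variable {E : Type*} [NormedAddCommGroup E] [NormedSpace 𝕜 E] {π : H →* (E ≃ₗᵢ[𝕜] E)} {b : H → E}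

theorem map_one (hb : IsIsometryCocycle π b) : b 1 = 0 := by
  simpa using hb 1 1

theorem norm_sub (hb : IsIsometryCocycle π b) (g h : H) : ‖b h - b g‖ = ‖b (g⁻¹ * h)‖ := by
  have := hb g (g⁻¹ * h)
  rw [mul_inv_cancel_left] at this
  rw [this, add_sub_cancel_left, LinearIsometryEquiv.norm_map]

/-- The linear part of an affine isometric action, as a homomorphism. -/
def linearPart (α : H →* (E ≃ᵃⁱ[𝕜] E)) : H →* (E ≃ₗᵢ[𝕜] E) where
  toFun g := (α g).linearIsometryEquiv
  map_one' := by
    rw [_root_.map_one]; rfl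
  map_mul' g h := by
    rw [map_mul]; rfl

theorem of_equivariant {α : H →* (E ≃ᵃⁱ[𝕜] E)} {f : H → E} (hf : ∀ g h, f (g * h) = α g (f h)) :
    IsIsometryCocycle (linearPart α) fun g => f g - f 1 := by
  intro g h
  change f (g * h) - f 1 = f g - f 1 + (α g).linearIsometryEquiv (f h - f 1)
  rw [← vsub_eq_sub (f h) (f 1), AffineIsometryEquiv.map_vsub, ← hf, ← hf, mul_one, vsub_eq_sub]
  abel

/-- The affine isometry `x ↦ π g x + b g`. -/
def affineIsometry (π : H →* (E ≃ₗᵢ[𝕜] E)) (b : H → E) (g : H) : E ≃ᵃⁱ[𝕜] E :=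
  (π g).toAffineIsometryEquiv.trans (AffineIsometryEquiv.constVAdd 𝕜 E (b g))

theorem affineIsometry_apply (g : H) (x : E) : affineIsometry π b g x = b g + π g x := rfl

theorem isAffineEquivariant (hb : IsIsometryCocycle π b) : IsAffineEquivariant 𝕜 b :=
  ⟨{ toFun := affineIsometry π b
     map_one' := AffineIsometryEquiv.ext fun x => by
       simp [affineIsometry_apply, hb.map_one]
     map_mul' := fun g h => AffineIsometryEquiv.ext fun x => by
       simp [affineIsometry_apply, hb g h, add_assoc] }, hb⟩

/-- Transport of a representation along an isometry. -/
def conj {F : Type*} [NormedAddCommGroup F] [NormedSpace 𝕜 F] (Θ : E ≃ₗᵢ[𝕜] F)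
    (π : H →* (E ≃ₗᵢ[𝕜] E)) : H →* (F ≃ₗᵢ[𝕜] F) where
  toFun g := (Θ.symm.trans (π g)).trans Θ
  map_one' := by ext; simp
  map_mul' g h := by ext; simp

theorem comp_isometry {F : Type*} [NormedAddCommGroup F] [NormedSpace 𝕜 F] (Θ : E ≃ₗᵢ[𝕜] F)
    (hb : IsIsometryCocycle π b) : IsIsometryCocycle (conj Θ π) fun g => Θ (b g) := by
  intro g h
  simp [conj, hb g h]

end IsIsometryCocycle

end Cocycles

/-! ### Functions ‖b‖^p for `Lp`-valued cocycles b. -/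

section Lengths

variable (𝕜 : Type k) [RCLike 𝕜] (p : ℝ≥0∞) [hp1 : Fact (1 ≤ p)]

/-- `ψ` is the `p`-th power of the norm of a cocycle of `H` with values in some `Lp`-space. -/
def IsLpLength {H : Type*} [Group H] (ψ : H → ℝ) : Prop :=
  ∃ (Ω : Type w) (_ : MeasurableSpace Ω) (μ : Measure Ω)
    (π : H →* (Lp 𝕜 p μ ≃ₗᵢ[𝕜] Lp 𝕜 p μ)) (b : H → Lp 𝕜 p μ),
    IsIsometryCocycle π b ∧ ∀ g, ψ g = ‖b g‖ ^ p.toReal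

variable {𝕜 p} {H : Type*} [Group H]

theorem IsLpLength.of_lp (hp : p ≠ ∞) {J : Type*} [Small.{w} J] {Ω : J → Type w}
    [∀ j, MeasurableSpace (Ω j)] {μ : ∀ j, Measure (Ω j)} {E : J → Type*}
    [∀ j, NormedAddCommGroup (E j)] [∀ j, NormedSpace 𝕜 (E j)] (Φ : ∀ j, E j ≃ₗᵢ[𝕜] Lp 𝕜 p (μ j))
    {π : H →* (lp E p ≃ₗᵢ[𝕜] lp E p)} {b : H → lp E p} (hb : IsIsometryCocycle π b) :
    IsLpLength.{w} 𝕜 p fun g => ∑' j, ‖b g j‖ ^ p.toReal := by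
  -- A copy of the index set in `Type w` keeps the disjoint union in the universe over which the
  -- compression ranges.
  let e : Shrink.{w} J ≃ J := (equivShrink J).symm
  let Θ : lp E p ≃ₗᵢ[𝕜] Lp 𝕜 p (sigmaMeasure fun i => μ (e i)) :=
    (lpReindex (F := fun i => Lp 𝕜 p (μ (e i))) hp e fun i => Φ (e i)).trans
      (sigmaLpEquiv (fun i => μ (e i)) hp).symm
  have hpos := ENNReal.toReal_pos (zero_lt_one.trans_le hp1.out).ne' hp
  refine ⟨_, _, _, _, _, hb.comp_isometry Θ, fun g => ?_⟩
  rw [LinearIsometryEquiv.norm_map, lp.norm_rpow_eq_tsum hpos]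

theorem IsLpLength.map_one (hp : p ≠ ∞) {ψ : H → ℝ} (hψ : IsLpLength.{w} 𝕜 p ψ) : ψ 1 = 0 := by
  obtain ⟨Ω, _, μ, π, b, hb, h⟩ := hψ
  have hpos := ENNReal.toReal_pos (zero_lt_one.trans_le hp1.out).ne' hp
  rw [h, hb.map_one, norm_zero, Real.zero_rpow hpos.ne']

theorem IsLpLength.nonneg {ψ : H → ℝ} (hψ : IsLpLength.{w} 𝕜 p ψ) (g : H) : 0 ≤ ψ g := by
  obtain ⟨Ω, _, μ, π, b, hb, h⟩ := hψ
  rw [h]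
  positivity

theorem IsLpLength.sum (hp : p ≠ ∞) {κ : Type*} [Fintype κ] {ψ : κ → H → ℝ}
    (hψ : ∀ i, IsLpLength.{w} 𝕜 p (ψ i)) : IsLpLength.{w} 𝕜 p fun g => ∑ i, ψ i g := by
  choose Ω mΩ μ π b hb h using hψ
  let U : H →* (lp (fun i => Lp 𝕜 p (μ i)) p ≃ₗᵢ[𝕜] lp (fun i => Lp 𝕜 p (μ i)) p) :=
    { toFun := fun g => lpReindex hp (Equiv.refl κ) fun i => π i g
      map_one' := by
        ext1 ξ
        refine lp.ext (funext fun i => ?_)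
        change π i 1 (ξ i) = ξ i
        simp
      map_mul' := fun g h => by
        ext1 ξ
        refine lp.ext (funext fun i => ?_)
        change π i (g * h) (ξ i) = π i g (π i h (ξ i))
        simp }
  have hB : IsIsometryCocycle U fun g => ⟨fun i => b i g, Memℓp.all _⟩ := fun g h =>
    lp.ext (funext fun i => hb i g h)
  convert IsLpLength.of_lp hp (fun i => LinearIsometryEquiv.refl 𝕜 (Lp 𝕜 p (μ i))) hB using 2 with g
  rw [tsum_fintype]
  exact Finset.sum_congr rfl fun i _ => h i g

theorem IsLpLength.add (hp : p ≠ ∞) {ψ₁ ψ₂ : H → ℝ} (h₁ : IsLpLength.{w} 𝕜 p ψ₁)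
    (h₂ : IsLpLength.{w} 𝕜 p ψ₂) : IsLpLength.{w} 𝕜 p fun g => ψ₁ g + ψ₂ g := by
  convert IsLpLength.sum hp (ψ := fun i : Bool => cond i ψ₁ ψ₂) (Bool.rec h₂ h₁) using 2
  simp

variable (𝕜 p) in
/-- Over a one-point space, `Lp` is the field of scalars. -/
noncomputable def lpDiracEquiv :
    𝕜 ≃ₗᵢ[𝕜] Lp 𝕜 p (Measure.dirac PUnit.unit : Measure PUnit.{w + 1}) :=
  LinearIsometryEquiv.ofSurjective
    ⟨Lp.constₗ p _ 𝕜, fun c => by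
      have hp0 : p ≠ 0 := (zero_lt_one.trans_le hp1.out).ne'
      change ‖Lp.const p (Measure.dirac PUnit.unit : Measure PUnit.{w + 1}) c‖ = ‖c‖
      rw [Lp.norm_const _ _ _ hp0]
      simp⟩
    fun f => ⟨f PUnit.unit, Lp.ext (by
      filter_upwards [Lp.coeFn_const (μ := (Measure.dirac PUnit.unit : Measure PUnit.{w + 1})) p
        (f PUnit.unit)] with x hx using hx)⟩

/-- Adding this length absorbs the additive constant `D` in compression estimates. It comes from the
cocycle δ_g − δ_1 of the left regular representation, whose coordinate at g ≠ 1 is 1. -/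
theorem exists_isLpLength_one_le (hp : p ≠ ∞) [Countable H] :
    ∃ ψ : H → ℝ, IsLpLength.{w} 𝕜 p ψ ∧ ∀ g, g ≠ 1 → 1 ≤ ψ g := by
  classical
  have hp0 : p ≠ 0 := (zero_lt_one.trans_le hp1.out).ne'
  have hpos := ENNReal.toReal_pos hp0 hp
  let U : H →* (lp (fun _ : H => 𝕜) p ≃ₗᵢ[𝕜] lp (fun _ : H => 𝕜) p) :=
    { toFun := fun g => lpReindex hp (Equiv.mulLeft g⁻¹) fun _ => LinearIsometryEquiv.refl 𝕜 𝕜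
      map_one' := by ext1 ξ; exact lp.ext (funext fun i => by simp)
      map_mul' := fun g h => by ext1 ξ; exact lp.ext (funext fun i => by simp) }
  let δ (h : H) : lp (fun _ : H => 𝕜) p := lp.single p h 1
  have hU : ∀ g h, U g (δ h) = δ (g * h) := fun g h => by
    refine lp.ext (funext fun i => ?_)
    change δ h (g⁻¹ * i) = δ (g * h) i
    simp [δ, lp.single_apply, Pi.single_apply, inv_mul_eq_iff_eq_mul]
  have hB : IsIsometryCocycle U fun g => δ g - δ 1 := fun g h => by
    rw [map_sub, hU, hU, mul_one, sub_add_sub_cancel']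
  refine ⟨_, IsLpLength.of_lp hp (fun _ => lpDiracEquiv 𝕜 p) hB, fun g hg => ?_⟩
  rw [← lp.norm_rpow_eq_tsum hpos]
  refine Real.one_le_rpow ?_ hpos.le
  refine le_trans ?_ (lp.norm_apply_le_norm hp0 _ g)
  simp [δ, lp.single_apply, hg]

/-! ### Inducing cocycles along a map equivariant under a subgroup. -/

section Induced

variable {G A : Type*} [Group G] [Group A] (σ : G → A)

/-- The largest subgroup along whose left translations `σ` is equivariant. -/
def equivariantSubgroup (h1 : σ 1 = 1) : Subgroup G where
  carrier := {q | ∀ y, σ (q * y) = σ q * σ y}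
  one_mem' := fun y => by simp [h1]
  mul_mem' := fun {a b} ha hb y => by
    rw [mul_assoc, ha, hb, ha b, mul_assoc]
  inv_mem' := fun {a} ha y => by
    have h : ∀ y, σ (a⁻¹ * y) = (σ a)⁻¹ * σ y := fun y => by
      rw [eq_inv_mul_iff_mul_eq, ← ha, mul_inv_cancel_left]
    have h' := h 1
    rw [mul_one, h1, mul_one] at h'
    rw [h, h']

variable {σ} (h1 : σ 1 = 1)

/-- Changing the coset representative multiplies both values of σ on the left by σ(x⁻¹y), which
cancels. -/
theorem map_inv_mul_equivariantSubgroup {x y : G} (h : x⁻¹ * y ∈ equivariantSubgroup σ h1)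
    (g g' : G) : (σ (x⁻¹ * g))⁻¹ * σ (x⁻¹ * g') = (σ (y⁻¹ * g))⁻¹ * σ (y⁻¹ * g') := by
  have key : ∀ g, σ (x⁻¹ * g) = σ (x⁻¹ * y) * σ (y⁻¹ * g) := fun g => by
    rw [← h]; group
  rw [key g, key g', mul_inv_rev, mul_assoc, inv_mul_cancel_left]

/-- The `A`-valued displacement between `1` and `g` seen from the coset `i`. -/
noncomputable def displacement (i : G ⧸ equivariantSubgroup σ h1) (g : G) : A :=
  (σ (i.out⁻¹))⁻¹ * σ (i.out⁻¹ * g)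

theorem displacement_mk (x g : G) :
    displacement h1 (x : G ⧸ equivariantSubgroup σ h1) g = (σ x⁻¹)⁻¹ * σ (x⁻¹ * g) := by
  have h := QuotientGroup.eq.1 (QuotientGroup.out_eq' (x : G ⧸ equivariantSubgroup σ h1))
  simpa [displacement] using map_inv_mul_equivariantSubgroup h1 h 1 g

theorem displacement_mul (i : G ⧸ equivariantSubgroup σ h1) (g h : G) :
    displacement h1 i (g * h) = displacement h1 i g * displacement h1 (g⁻¹ • i) h := by
  obtain ⟨x, rfl⟩ := QuotientGroup.mk_surjective i
  rw [show g⁻¹ • (x : G ⧸ equivariantSubgroup σ h1) = ((g⁻¹ * x : G) : G ⧸ _) from rfl]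
  simp only [displacement_mk, mul_inv_rev, inv_inv]
  group

theorem finite_displacement_ne_one {S : Set G} (hS : Submonoid.closure S = ⊤)
    (h : ∀ s ∈ S, {i | displacement h1 i s ≠ 1}.Finite) (g : G) :
    {i | displacement h1 i g ≠ 1}.Finite := by
  have hg : g ∈ Submonoid.closure S := hS ▸ Submonoid.mem_top g
  induction hg using Submonoid.closure_induction with
  | mem s hs => exact h s hs
  | one => simp [displacement]
  | mul g g' _ _ hg hg' =>
    refine (hg.union (hg'.preimage ((MulAction.injective g⁻¹).injOn))).subset fun i hi => ?_
    by_contra hc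
    simp only [Set.mem_union, Set.mem_preimage, Set.mem_ofPred_eq, not_or, not_not] at hc
    exact hi (by rw [displacement_mul, hc.1, hc.2, mul_one])

/-- The cocycle is the formal coboundary of the family b(σ(i.out⁻¹)). That family need not be
p-summable, but its differences have finite support. The elements `t g i` compare the chosen
representatives of i and g⁻¹i and twist the permutation of the summands. -/
theorem IsLpLength.induced (hp : p ≠ ∞) [Countable G] {ψ : A → ℝ} (hψ : IsLpLength.{w} 𝕜 p ψ)
    (hfin : ∀ g, {i | displacement h1 i g ≠ 1}.Finite) :
    IsLpLength.{w} 𝕜 p fun g => ∑' i, ψ (displacement h1 i g) := by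
  obtain ⟨Ω, _, μ, π, b, hb, h⟩ := hψ
  have : Countable (G ⧸ equivariantSubgroup σ h1) := Quotient.countable
  let t (g : G) (i : G ⧸ equivariantSubgroup σ h1) : A := σ (i.out⁻¹ * g * (g⁻¹ • i).out)
  have hmem : ∀ g (i : G ⧸ equivariantSubgroup σ h1),
      i.out⁻¹ * g * (g⁻¹ • i).out ∈ equivariantSubgroup σ h1 := fun g i => by
    have : ((g⁻¹ * i.out : G) : G ⧸ equivariantSubgroup σ h1) = ((g⁻¹ • i).out : G) := by
      rw [QuotientGroup.out_eq', ← smul_eq_mul, ← MulAction.Quotient.smul_coe,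
        QuotientGroup.out_eq']
    simpa [mul_assoc] using QuotientGroup.eq.1 this
  have ht : ∀ g i y, σ (i.out⁻¹ * g * y) = t g i * σ ((g⁻¹ • i).out⁻¹ * y) := fun g i y => by
    rw [← hmem g i]; group
  have ht_mul : ∀ g g' i, t (g * g') i = t g i * t g' (g⁻¹ • i) := fun g g' i => by
    have := ht g i (g' * ((g * g')⁻¹ • i).out)
    rw [mul_inv_rev, mul_smul] at this
    simp only [t, mul_inv_rev, mul_smul, mul_assoc] at this ⊢
    exact this
  have ht_one : ∀ i, t 1 i = 1 := fun i => by simp [t, h1]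
  let U : G →* (lp (fun _ : G ⧸ equivariantSubgroup σ h1 => Lp 𝕜 p μ) p ≃ₗᵢ[𝕜]
      lp (fun _ : G ⧸ equivariantSubgroup σ h1 => Lp 𝕜 p μ) p) :=
    { toFun := fun g => lpReindex hp (MulAction.toPerm g⁻¹) fun i => π (t g i)
      map_one' := by
        ext1 ξ
        exact lp.ext (funext fun i => by simp [ht_one])
      map_mul' := fun g g' => by
        ext1 ξ
        exact lp.ext (funext fun i => by simp [ht_mul, mul_smul]) }
  have hmemp : ∀ g, Memℓp (fun i : G ⧸ equivariantSubgroup σ h1 =>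
      b (σ (i.out⁻¹ * g)) - b (σ i.out⁻¹)) p := fun g => by
    refine (memℓp_zero ((hfin g).subset fun i hi hc => hi ?_)).of_exponent_ge zero_le
    rw [displacement, inv_mul_eq_one] at hc
    simp [hc]
  have hB : IsIsometryCocycle U fun g => ⟨_, hmemp g⟩ := fun g g' => by
    refine lp.ext (funext fun i => ?_)
    change b (σ (i.out⁻¹ * (g * g'))) - b (σ i.out⁻¹) = b (σ (i.out⁻¹ * g)) - b (σ i.out⁻¹) +
      π (t g i) (b (σ ((g⁻¹ • i).out⁻¹ * g')) - b (σ (g⁻¹ • i).out⁻¹))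
    have e1 := ht g i 1
    have e2 := ht g i g'
    rw [mul_one, mul_one] at e1
    rw [← mul_assoc, e1, e2, hb, hb, map_sub]
    abel
  convert IsLpLength.of_lp hp (fun _ => LinearIsometryEquiv.refl 𝕜 (Lp 𝕜 p μ)) hB using 4 with g i
  rw [h, displacement, ← hb.norm_sub]

end Induced

end Lengths

/-! ### First letters of reduced words in free products. -/

namespace Monoid.CoprodI

section Head

variable {ι : Type*} {M : ι → Type*} [∀ i, Monoid (M i)]

open scoped Classical in
/-- The first letter of the reduced word of `m` if it lies in `M i`, and `1` otherwise. -/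
noncomputable def head (i : ι) (m : CoprodI M) : M i :=
  (Word.equivPair i (m • Word.empty)).head

theorem head_one (i : ι) : head i (1 : CoprodI M) = 1 := by
  classical
  rw [head, one_smul, Word.equivPair_eq_of_fstIdx_ne (by simp [Word.fstIdx, Word.empty])]

theorem head_of_mul {i : ι} (a : M i) (m : CoprodI M) : head i (of a * m) = a * head i m := by
  classical
  rw [head, mul_smul, Word.equivPair_smul_same, head]

theorem head_of_mul_of_ne {i l : ι} (hl : l ≠ i) {b : M l} (hb : b ≠ 1) {m : CoprodI M}
    (hm : head l m = 1) : head i (of b * m) = 1 := by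
  classical
  rw [head] at hm
  rw [head, mul_smul, Word.of_smul_def, Word.equivPair_eq_of_fstIdx_ne]
  simp [hm, Word.rcons, hb, Word.fstIdx_cons, hl]

theorem head_of_of_ne {i l : ι} (hl : l ≠ i) (b : M l) : head i (of b : CoprodI M) = 1 := by
  by_cases hb : b = 1
  · rw [hb, map_one, head_one]
  · simpa using head_of_mul_of_ne hl hb (head_one l)

theorem head_of (i : ι) (b : M i) : head i (of b : CoprodI M) = b := by
  simpa [head_one] using head_of_mul b 1

/-- The normal form as an induction principle: `head l m = 1` says that prefixing b keeps the word
reduced. -/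
theorem reduced_induction {motive : CoprodI M → Prop} (m : CoprodI M) (one : motive 1)
    (of_mul : ∀ (l : ι) (b : M l) (m : CoprodI M), b ≠ 1 → head l m = 1 → motive m →
      motive (of b * m)) : motive m := by
  classical
  rw [← Word.equiv.symm_apply_apply m]
  generalize Word.equiv m = x
  change motive x.prod
  induction x using Word.consRecOn with
  | empty => simpa using one
  | cons l b x h1 h2 ih =>
    rw [Word.prod_cons]
    refine of_mul l b _ h2 ?_ ih
    have : x.prod • (Word.empty : Word M) = x := Word.equiv.apply_symm_apply x
    rw [head, this, Word.equivPair_eq_of_fstIdx_ne h1]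

/-- Right multiplication by a letter affects only the end of the word, which meets its beginning
only if there is at most one letter. -/
theorem head_mul_of (m : CoprodI M) {j : ι} (s : M j) (i : ι) :
    head i (m * of s) = head i m ∨ i = j ∧ ∃ a : M j, m = of a := by
  induction m using reduced_induction generalizing i with
  | one =>
    by_cases hi : i = j
    · exact .inr ⟨hi, 1, (map_one _).symm⟩
    · rw [one_mul, head_of_of_ne (Ne.symm hi), head_one]
      exact .inl rfl
  | of_mul l b m hb hm ih =>
    by_cases hl : l = i
    · subst hl
      rw [mul_assoc, head_of_mul, head_of_mul]
      rcases ih l with h | ⟨rfl, a, rfl⟩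
      · rw [h]
        exact .inl rfl
      · exact .inr ⟨rfl, b * a, (map_mul _ _ _).symm⟩
    · left
      rw [head_of_mul_of_ne hl hb hm]
      rcases ih l with h | ⟨rfl, a, rfl⟩
      · rw [mul_assoc, head_of_mul_of_ne hl hb (h.trans hm)]
      · rw [head_of] at hm
        rw [hm, map_one, mul_one, ← map_mul, head_of_of_ne hl]

end Head

section Permute

variable {X A K : Type*} [Group A] [Group K] [MulAction K X]

variable (X A) in
/-- Permutation of the factors of a free product of copies of `A`. -/
def permuteHom (k : K) : CoprodI (fun _ : X => A) →* CoprodI (fun _ : X => A) :=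
  lift fun x => of (M := fun _ : X => A) (i := k • x)

theorem permuteHom_of (k : K) (x : X) (a : A) :
    permuteHom X A k (of (M := fun _ : X => A) (i := x) a) =
      of (M := fun _ : X => A) (i := k • x) a :=
  lift_of _ _

theorem head_permuteHom (k : K) (i : X) (m : CoprodI (fun _ : X => A)) :
    head (k • i) (permuteHom X A k m) = head i m := by
  induction m using reduced_induction generalizing i with
  | one => rw [map_one, head_one, head_one]
  | of_mul l b m hb hm ih =>
    rw [map_mul, permuteHom_of]
    by_cases hl : l = i
    · subst hl
      rw [head_of_mul, head_of_mul, ih]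
    · rw [head_of_mul_of_ne hl hb hm,
        head_of_mul_of_ne (M := fun _ : X => A) (fun h => hl (MulAction.injective k h)) hb
          ((ih l).trans hm)]

variable (X A K) in
/-- The action of `K` on a free product of copies of `A` by permutation of the factors. -/
def permute : K →* MulAut (CoprodI (fun _ : X => A)) where
  toFun k := MonoidHom.toMulEquiv (permuteHom X A k) (permuteHom X A k⁻¹)
    (ext_hom _ _ fun x => MonoidHom.ext fun a => by
      simp [permuteHom_of])
    (ext_hom _ _ fun x => MonoidHom.ext fun a => by
      simp [permuteHom_of])
  map_one' := by
    ext m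
    change permuteHom X A (1 : K) m = MonoidHom.id _ m
    congr 1
    exact ext_hom _ _ fun x => MonoidHom.ext fun a => by simp [permuteHom_of]
  map_mul' k k' := by
    ext m
    change permuteHom X A (k * k') m = ((permuteHom X A k).comp (permuteHom X A k')) m
    congr 1
    exact ext_hom _ _ fun x => MonoidHom.ext fun a => by simp [permuteHom_of, mul_smul]

theorem permute_apply (k : K) (m : CoprodI (fun _ : X => A)) :
    permute X A K k m = permuteHom X A k m := rfl

end Permute

end Monoid.CoprodI

/-! ### First syllables in graph products. -/

namespace GraphProduct

open Monoid

variable {V : Type v} (Γ : SimpleGraph V) (G : V → Type u) [∀ a, Group (G a)]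

/-- The inclusion of a vertex group. -/
def of (a : V) : G a →* GraphProduct Γ G :=
  (QuotientGroup.mk' (Subgroup.normalClosure (graphProductRelators Γ G))).comp CoprodI.of

variable {Γ G}

theorem commute_of {a b : V} (hab : Γ.Adj a b) (g : G a) (h : G b) :
    of Γ G a g * of Γ G b h = of Γ G b h * of Γ G a g := by
  have : (QuotientGroup.mk' (Subgroup.normalClosure (graphProductRelators Γ G)))
      ((CoprodI.of g)⁻¹ * (CoprodI.of h)⁻¹ * CoprodI.of g * CoprodI.of h) = 1 :=
    (QuotientGroup.eq_one_iff _).2 (Subgroup.subset_normalClosure ⟨a, b, hab, g, h, rfl⟩)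
  rw [map_mul, map_mul, map_mul, map_inv, map_inv] at this
  change (of Γ G a g)⁻¹ * (of Γ G b h)⁻¹ * of Γ G a g * of Γ G b h = 1 at this
  rwa [← mul_inv_rev, mul_assoc, inv_mul_eq_one, eq_comm] at this

/-- The universal property of a graph product. -/
def lift {P : Type*} [Group P] (f : ∀ a, G a →* P)
    (hf : ∀ a b, Γ.Adj a b → ∀ (g : G a) (h : G b), f a g * f b h = f b h * f a g) :
    GraphProduct Γ G →* P :=
  QuotientGroup.lift _ (CoprodI.lift f) (Subgroup.normalClosure_le_normal (by
    rintro _ ⟨a, b, hab, g, h, rfl⟩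
    simp only [SetLike.mem_coe, MonoidHom.mem_ker, map_mul, map_inv, CoprodI.lift_of]
    rw [← mul_inv_rev, mul_assoc, inv_mul_eq_one, hf a b hab]))

@[simp]
theorem lift_of {P : Type*} [Group P] (f : ∀ a, G a →* P)
    (hf : ∀ a b, Γ.Adj a b → ∀ (g : G a) (h : G b), f a g * f b h = f b h * f a g) (a : V)
    (g : G a) : lift f hf (of Γ G a g) = f a g :=
  CoprodI.lift_of _ _

theorem hom_ext {P : Type*} [Group P] {f f' : GraphProduct Γ G →* P}
    (h : ∀ a g, f (of Γ G a g) = f' (of Γ G a g)) : f = f' :=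
  QuotientGroup.monoidHom_ext _ (CoprodI.ext_hom _ _ fun a => MonoidHom.ext fun g => h a g)

/-- The product of a list of syllables. -/
def syllableProd (l : List (Σ a, G a)) : GraphProduct Γ G :=
  (l.map fun s => of Γ G s.1 s.2).prod

theorem exists_syllableProd (x : GraphProduct Γ G) : ∃ l, syllableProd l = x := by
  obtain ⟨m, rfl⟩ := QuotientGroup.mk_surjective x
  induction m using CoprodI.induction_left with
  | one => exact ⟨[], rfl⟩
  | mul s m ih =>
    obtain ⟨l, hl⟩ := ih
    refine ⟨⟨_, s⟩ :: l, ?_⟩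
    rw [syllableProd, List.map_cons, List.prod_cons]
    change _ * syllableProd l = _
    rw [hl]
    rfl

theorem closure_iUnion_range_of :
    Submonoid.closure (⋃ a, Set.range (of Γ G a)) = ⊤ := by
  refine eq_top_iff.2 fun x _ => ?_
  obtain ⟨l, rfl⟩ := exists_syllableProd x
  refine Submonoid.list_prod_mem _ fun y hy => Submonoid.subset_closure ?_
  obtain ⟨s, -, rfl⟩ := List.mem_map.1 hy
  exact Set.mem_iUnion.2 ⟨s.1, s.2, rfl⟩

section FirstSyllable

variable (Γ G) (v : V)

/-- The subgroup generated by the vertex groups of the neighbours of `v`. -/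
def link : Subgroup (GraphProduct Γ G) :=
  Subgroup.closure {x | ∃ a, Γ.Adj v a ∧ ∃ g, of Γ G a g = x}

variable {Γ G v}

theorem of_mul_of_mem_link {k : GraphProduct Γ G} (hk : k ∈ link Γ G v) (s : G v) :
    of Γ G v s * k = k * of Γ G v s := by
  have h : link Γ G v ≤ Subgroup.centralizer {of Γ G v s} := by
    refine (Subgroup.closure_le _).2 ?_
    rintro _ ⟨a, ha, g, rfl⟩
    exact Subgroup.mem_centralizer_singleton_iff.2 (commute_of ha s g).symm
  exact (Subgroup.mem_centralizer_singleton_iff.1 (h hk)).symm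

variable (Γ G v)

/-- The free product of copies of `G v` indexed by the cosets of the link of `v`, extended by the
graph product acting on the index set. -/
abbrev LinkExtension : Type _ :=
  CoprodI (fun _ : GraphProduct Γ G ⧸ link Γ G v => G v) ⋊[CoprodI.permute
    (GraphProduct Γ G ⧸ link Γ G v) (G v) (GraphProduct Γ G)] GraphProduct Γ G

/-- The copy of `G v` indexed by `x`. -/
def factor (x : GraphProduct Γ G ⧸ link Γ G v) : G v →* LinkExtension Γ G v :=
  SemidirectProduct.inl.comp
    (CoprodI.of (M := fun _ : GraphProduct Γ G ⧸ link Γ G v => G v) (i := x))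

theorem inr_mul_factor (k : GraphProduct Γ G) (x : GraphProduct Γ G ⧸ link Γ G v) (s : G v) :
    (SemidirectProduct.inr k : LinkExtension Γ G v) * factor Γ G v x s =
      factor Γ G v (k • x) s * SemidirectProduct.inr k := by
  refine SemidirectProduct.ext ?_ ?_
  · simp [factor, CoprodI.permute_apply, CoprodI.permuteHom_of]
  · simp [factor]

open scoped Classical in
/-- The map of `G a` to the extension: `G v` goes to the base copy, and the other vertex groups
go to the complement. -/
noncomputable def toLinkExtensionVertex (a : V) : G a →* LinkExtension Γ G v :=
  if h : v = a then h ▸ factor Γ G v ((1 : GraphProduct Γ G) : GraphProduct Γ G ⧸ link Γ G v)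
  else SemidirectProduct.inr.comp (of Γ G a)

theorem toLinkExtensionVertex_self : toLinkExtensionVertex Γ G v v =
    factor Γ G v ((1 : GraphProduct Γ G) : GraphProduct Γ G ⧸ link Γ G v) :=
  dif_pos rfl

variable {v} in
theorem toLinkExtensionVertex_of_ne {a : V} (h : v ≠ a) :
    toLinkExtensionVertex Γ G v a = SemidirectProduct.inr.comp (of Γ G a) :=
  dif_neg h

variable {Γ G v} in
theorem smul_one_eq_iff {k : GraphProduct Γ G} :
    k • ((1 : GraphProduct Γ G) : GraphProduct Γ G ⧸ link Γ G v) = (1 : GraphProduct Γ G) ↔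
      k ∈ link Γ G v := by
  rw [← MulAction.mem_stabilizer_iff, MulAction.stabilizer_quotient]

variable {Γ G v} in
theorem of_mem_link {a : V} (h : Γ.Adj v a) (g : G a) : of Γ G a g ∈ link Γ G v :=
  Subgroup.subset_closure ⟨a, h, g, rfl⟩

/-- The map of the graph product to the extension. -/
noncomputable def toLinkExtension : GraphProduct Γ G →* LinkExtension Γ G v :=
  lift (toLinkExtensionVertex Γ G v) fun a b hab g h => by
    -- The relations at v survive because the link fixes the base coset, hence commutes with the
    -- base copy of G v.
    have key : ∀ b, Γ.Adj v b → ∀ (g : G v) (h : G b), toLinkExtensionVertex Γ G v v g *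
        toLinkExtensionVertex Γ G v b h =
        toLinkExtensionVertex Γ G v b h * toLinkExtensionVertex Γ G v v g := fun b hb g h => by
      rw [toLinkExtensionVertex_self, toLinkExtensionVertex_of_ne Γ G hb.ne, MonoidHom.comp_apply,
        inr_mul_factor, smul_one_eq_iff.2 (of_mem_link hb h)]
    by_cases ha : v = a
    · subst ha
      exact key b hab g h
    by_cases hb : v = b
    · subst hb
      exact (key a hab.symm h g).symm
    rw [toLinkExtensionVertex_of_ne Γ G ha, toLinkExtensionVertex_of_ne Γ G hb,
      MonoidHom.comp_apply, MonoidHom.comp_apply, ← map_mul, commute_of hab, map_mul]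

theorem toLinkExtension_of_self (s : G v) : toLinkExtension Γ G v (of Γ G v s) =
    factor Γ G v ((1 : GraphProduct Γ G) : GraphProduct Γ G ⧸ link Γ G v) s := by
  rw [toLinkExtension, lift_of, toLinkExtensionVertex_self]

variable {v} in
theorem toLinkExtension_of_ne {a : V} (h : v ≠ a) (s : G a) :
    toLinkExtension Γ G v (of Γ G a s) = SemidirectProduct.inr (of Γ G a s) := by
  rw [toLinkExtension, lift_of, toLinkExtensionVertex_of_ne Γ G h, MonoidHom.comp_apply]

variable {Γ G v} in
-- The link commutes with G v, so conjugates of G v are indexed by cosets of the link; this makes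
-- `ofLinkExtension` compatible with the action.
theorem conj_of_eq {x y : GraphProduct Γ G} (h : (x : GraphProduct Γ G ⧸ link Γ G v) = y)
    (s : G v) : x * of Γ G v s * x⁻¹ = y * of Γ G v s * y⁻¹ := by
  have := of_mul_of_mem_link (QuotientGroup.eq.1 h) s
  obtain ⟨k, rfl⟩ : ∃ k, y = x * k := ⟨x⁻¹ * y, by group⟩
  rw [inv_mul_cancel_left] at this
  rw [mul_assoc x k, ← this]
  group

/-- A left inverse of `toLinkExtension`. -/
noncomputable def ofLinkExtension : LinkExtension Γ G v →* GraphProduct Γ G :=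
  SemidirectProduct.lift
    (CoprodI.lift fun x : GraphProduct Γ G ⧸ link Γ G v =>
      (MulAut.conj x.out).toMonoidHom.comp (of Γ G v))
    (MonoidHom.id _) fun k => CoprodI.ext_hom _ _ fun x => MonoidHom.ext fun s => by
      have : ((k • x).out : GraphProduct Γ G ⧸ link Γ G v) = (k * x.out : GraphProduct Γ G) := by
        rw [QuotientGroup.out_eq', ← smul_eq_mul, ← MulAction.Quotient.smul_coe,
          QuotientGroup.out_eq']
      simp [CoprodI.permute_apply, CoprodI.permuteHom_of, conj_of_eq this s, mul_assoc]

theorem ofLinkExtension_factor_one (s : G v) : ofLinkExtension Γ G v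
    (factor Γ G v ((1 : GraphProduct Γ G) : GraphProduct Γ G ⧸ link Γ G v) s) = of Γ G v s := by
  have := conj_of_eq (QuotientGroup.out_eq' ((1 : GraphProduct Γ G) : _ ⧸ link Γ G v)) s
  simpa [ofLinkExtension, factor] using this

theorem ofLinkExtension_inr (k : GraphProduct Γ G) :
    ofLinkExtension Γ G v (SemidirectProduct.inr k) = k := by
  simp [ofLinkExtension]

theorem ofLinkExtension_toLinkExtension (x : GraphProduct Γ G) :
    ofLinkExtension Γ G v (toLinkExtension Γ G v x) = x := by
  have : (ofLinkExtension Γ G v).comp (toLinkExtension Γ G v) = MonoidHom.id _ :=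
    hom_ext fun a s => by
      by_cases ha : v = a
      · subst ha
        simp [toLinkExtension_of_self, ofLinkExtension_factor_one]
      · simp [toLinkExtension_of_ne Γ G ha, ofLinkExtension_inr]
  exact DFunLike.congr_fun this x

/-- The first syllable of `x` that can be shuffled to the front and lies in `G v`, or `1` if there
is none. -/
noncomputable def firstSyllable (x : GraphProduct Γ G) : G v :=
  CoprodI.head ((1 : GraphProduct Γ G) : GraphProduct Γ G ⧸ link Γ G v)
    (toLinkExtension Γ G v x).left

variable {Γ G v}

theorem firstSyllable_one : firstSyllable Γ G v 1 = 1 := by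
  rw [firstSyllable, map_one, SemidirectProduct.one_left, CoprodI.head_one]

theorem firstSyllable_of_mul (s : G v) (x : GraphProduct Γ G) :
    firstSyllable Γ G v (of Γ G v s * x) = s * firstSyllable Γ G v x := by
  rw [firstSyllable, map_mul, toLinkExtension_of_self, SemidirectProduct.mul_left]
  simp only [factor, MonoidHom.comp_apply, SemidirectProduct.left_inl, SemidirectProduct.right_inl,
    map_one, MulAut.one_apply]
  exact CoprodI.head_of_mul (M := fun _ : GraphProduct Γ G ⧸ link Γ G v => G v) s _

/-- The letter only permutes the factors of the free product, and it fixes the base one. -/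
theorem firstSyllable_of_mul_of_adj {a : V} (ha : Γ.Adj v a) (s : G a) (x : GraphProduct Γ G) :
    firstSyllable Γ G v (of Γ G a s * x) = firstSyllable Γ G v x := by
  rw [firstSyllable, map_mul, toLinkExtension_of_ne Γ G ha.ne, SemidirectProduct.mul_left,
    SemidirectProduct.left_inr, SemidirectProduct.right_inr, one_mul, CoprodI.permute_apply]
  conv_lhs => rw [← smul_one_eq_iff.2 (of_mem_link ha s)]
  rw [CoprodI.head_permuteHom, firstSyllable]

theorem firstSyllable_mul_of_mem_link {k : GraphProduct Γ G} (hk : k ∈ link Γ G v)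
    (x : GraphProduct Γ G) : firstSyllable Γ G v (k * x) = firstSyllable Γ G v x := by
  induction hk using Subgroup.closure_induction generalizing x with
  | mem k hk =>
    obtain ⟨a, ha, s, rfl⟩ := hk
    exact firstSyllable_of_mul_of_adj ha s x
  | one => rw [one_mul]
  | mul k k' _ _ h h' => rw [mul_assoc, h, h']
  | inv k _ h => rw [← h, mul_inv_cancel_left]

theorem firstSyllable_mul_of_ne {a : V} (ha : v ≠ a) (x : GraphProduct Γ G) (s : G a) :
    firstSyllable Γ G v (x * of Γ G a s) = firstSyllable Γ G v x := by
  rw [firstSyllable, map_mul, toLinkExtension_of_ne Γ G ha, SemidirectProduct.mul_left,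
    SemidirectProduct.left_inr, map_one, mul_one, firstSyllable]

/-- With k the right component of the image of x, s is appended to the left component as a letter of
the factor k•1. By `head_mul_of` the head can change only if the left component is a letter a and
k•1 is the base coset, so k lies in the link; the left inverse then returns x = a·k. -/
theorem firstSyllable_mul_of (x : GraphProduct Γ G) (s : G v) :
    firstSyllable Γ G v (x * of Γ G v s) = firstSyllable Γ G v x ∨
      ∃ (a : G v) (k : GraphProduct Γ G), k ∈ link Γ G v ∧ x = of Γ G v a * k := by
  have := CoprodI.head_mul_of (toLinkExtension Γ G v x).left
    (j := (toLinkExtension Γ G v x).right •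
      ((1 : GraphProduct Γ G) : GraphProduct Γ G ⧸ link Γ G v)) s
    ((1 : GraphProduct Γ G) : GraphProduct Γ G ⧸ link Γ G v)
  refine this.imp (fun h => ?_) fun ⟨h, a, ha⟩ => ⟨a, _, smul_one_eq_iff.1 h.symm, ?_⟩
  · rw [firstSyllable, map_mul, toLinkExtension_of_self, SemidirectProduct.mul_left]
    exact h
  · conv_lhs => rw [← ofLinkExtension_toLinkExtension Γ G v x,
      ← SemidirectProduct.inl_left_mul_inr_right (toLinkExtension Γ G v x), ha, ← h, map_mul,
      ofLinkExtension_inr]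
    congr 1
    exact ofLinkExtension_factor_one Γ G v a

end FirstSyllable

end GraphProduct

theorem tsum_eq_add_tsum_of_perm {α : Type*} {f f' : α → ℝ} (hf : Summable f) (e : Equiv.Perm α)
    {c : α} {a : ℝ} (h : ∀ i, i ≠ c → f' i = f (e i)) (hc : f (e c) = 0) (hc' : f' c = a) :
    ∑' i, f' i = a + ∑' i, f i := by
  classical
  rw [← ((hasSum_ite_eq c a).add (e.hasSum_iff.2 hf.hasSum)).tsum_eq]
  refine tsum_congr fun i => ?_
  by_cases hi : i = c
  · subst hi
    simp [hc, hc']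
  · simp [hi, h i hi]

/-! ### Displacements over the cosets of the star and their sum. -/

namespace GraphProduct

open Monoid

variable {V : Type v} {Γ : SimpleGraph V} {G : V → Type u} [∀ a, Group (G a)]

section Star

variable (Γ G) (v : V)

/-- The subgroup of all `q` with `firstSyllable (q * y) = firstSyllable q * firstSyllable y` for
all `y`; it contains `G v` and the link of `v`. -/
noncomputable abbrev star : Subgroup (GraphProduct Γ G) :=
  equivariantSubgroup (firstSyllable Γ G v) firstSyllable_one

variable {Γ G v}

theorem of_mul_mem_star (a : G v) {k : GraphProduct Γ G} (hk : k ∈ link Γ G v) :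
    of Γ G v a * k ∈ star Γ G v := fun y => by
  have h := firstSyllable_mul_of_mem_link hk 1
  rw [mul_one, firstSyllable_one] at h
  rw [mul_assoc, firstSyllable_of_mul, firstSyllable_mul_of_mem_link hk, firstSyllable_of_mul, h,
    mul_one]

theorem of_mem_star (a : G v) : of Γ G v a ∈ star Γ G v := by
  simpa using of_mul_mem_star a (one_mem (link Γ G v))

variable (v)

/-- The displacement of `1` under `g` in the copy of `G v` at the coset `i`. -/
noncomputable abbrev disp (i : GraphProduct Γ G ⧸ star Γ G v) (g : GraphProduct Γ G) : G v :=
  displacement firstSyllable_one i g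

variable {v}

theorem disp_of_of_ne {a : V} (ha : v ≠ a) (i : GraphProduct Γ G ⧸ star Γ G v) (s : G a) :
    disp v i (of Γ G a s) = 1 := by
  rw [disp, displacement, firstSyllable_mul_of_ne ha, inv_mul_cancel]

/-- A displacement at the coset of x puts x⁻¹ in G v·link, which lies in the star, so the coset is
the base one. -/
theorem disp_of {i : GraphProduct Γ G ⧸ star Γ G v} (hi : i ≠ (1 : GraphProduct Γ G)) (s : G v) :
    disp v i (of Γ G v s) = 1 := by
  obtain ⟨x, rfl⟩ := QuotientGroup.mk_surjective i
  rw [disp, displacement_mk, inv_mul_eq_one]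
  rcases firstSyllable_mul_of x⁻¹ s with h | ⟨a, k, hk, hx⟩
  · exact h.symm
  · refine absurd (QuotientGroup.eq.2 ?_) hi
    rw [mul_one, hx]
    exact of_mul_mem_star a hk

theorem disp_one (g : GraphProduct Γ G) :
    disp v ((1 : GraphProduct Γ G) : GraphProduct Γ G ⧸ star Γ G v) g = firstSyllable Γ G v g := by
  rw [disp, displacement_mk, inv_one, firstSyllable_one, inv_one, one_mul, one_mul]

theorem of_inv_smul_one (s : G v) :
    (of Γ G v s)⁻¹ • ((1 : GraphProduct Γ G) : GraphProduct Γ G ⧸ star Γ G v) =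
      (1 : GraphProduct Γ G) := by
  rw [← MulAction.mem_stabilizer_iff, MulAction.stabilizer_quotient]
  exact inv_mem (of_mem_star s)

theorem finite_disp_ne_one (g : GraphProduct Γ G) : {i | disp v i g ≠ 1}.Finite := by
  refine finite_displacement_ne_one firstSyllable_one closure_iUnion_range_of (fun s hs => ?_) g
  obtain ⟨a, s, rfl⟩ := Set.mem_iUnion.1 hs
  by_cases ha : v = a
  · subst ha
    refine (Set.finite_singleton ((1 : GraphProduct Γ G) : GraphProduct Γ G ⧸ star Γ G v)).subset
      fun i hi => ?_
    by_contra h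
    exact hi (disp_of h s)
  · refine Set.finite_empty.subset fun i hi => hi (disp_of_of_ne ha i s)

end Star

theorem syllableProd_cons (s : Σ a, G a) (l : List (Σ a, G a)) :
    (syllableProd (s :: l) : GraphProduct Γ G) = of Γ G s.1 s.2 * syllableProd l := by
  simp [syllableProd]

theorem syllableProd_append (l l' : List (Σ a, G a)) :
    (syllableProd (l ++ l') : GraphProduct Γ G) = syllableProd l * syllableProd l' := by
  simp [syllableProd]

/-- Splitting off a nontrivial first syllable shortens a product of syllables. -/
theorem exists_shorter {v : V} (l : List (Σ a, G a))
    (hl : firstSyllable Γ G v (syllableProd l) ≠ 1) :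
    ∃ l' : List (Σ a, G a), l'.length < l.length ∧
      syllableProd l = of Γ G v (firstSyllable Γ G v (syllableProd l)) * syllableProd l' := by
  induction l using List.reverseRecOn with
  | nil => exact absurd firstSyllable_one hl
  | append_singleton l s ih =>
    obtain ⟨a, s⟩ := s
    have hs : (syllableProd [(⟨a, s⟩ : Σ a, G a)] : GraphProduct Γ G) = of Γ G a s := by
      simp [syllableProd]
    rw [syllableProd_append, hs] at hl ⊢
    by_cases heq : firstSyllable Γ G v (syllableProd l * of Γ G a s) =
        firstSyllable Γ G v (syllableProd l)
    · rw [heq] at hl ⊢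
      obtain ⟨l', hlt, h⟩ := ih hl
      refine ⟨l' ++ [⟨a, s⟩], by simpa using hlt, ?_⟩
      rw [syllableProd_append, hs, ← mul_assoc, ← h]
    · have ha : v = a := by
        by_contra ha
        exact heq (firstSyllable_mul_of_ne ha _ s)
      subst ha
      obtain ⟨b, k, hk, hb⟩ := (firstSyllable_mul_of (syllableProd l) s).resolve_left heq
      have hfk := firstSyllable_mul_of_mem_link hk 1
      rw [mul_one, firstSyllable_one] at hfk
      have hfb : firstSyllable Γ G v (syllableProd l) = b := by
        rw [hb, firstSyllable_of_mul, hfk, mul_one]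
      have hcomm : syllableProd l * of Γ G v s = of Γ G v (b * s) * k := by
        rw [hb, mul_assoc, ← of_mul_of_mem_link hk, ← mul_assoc, map_mul]
      rw [hcomm, firstSyllable_of_mul, hfk, mul_one]
      -- The prefix is b·k with k in the link, so s passes k and merges with b. The appended
      -- syllable leaves one unit of length to spare, hence ≤ suffices.
      suffices ∃ l' : List (Σ a, G a), l'.length ≤ l.length ∧ syllableProd l' = k by
        obtain ⟨l', h, rfl⟩ := this
        exact ⟨l', by simpa [Nat.lt_succ_iff] using h, rfl⟩
      by_cases hb1 : b = 1
      · exact ⟨l, le_rfl, by rw [hb, hb1, map_one, one_mul]⟩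
      · obtain ⟨l', h, h'⟩ := ih (by rwa [hfb])
        rw [hfb, hb] at h'
        exact ⟨l', h.le, (mul_left_cancel h').symm⟩

section Length

variable {ψ : ∀ a, G a → ℝ}

theorem summable_disp (hψ : ∀ a, ψ a 1 = 0) (v : V) (g : GraphProduct Γ G) : Summable fun i => ψ v (disp v i g) :=
  summable_of_hasFiniteSupport ((finite_disp_ne_one g).subset fun i hi h => hi (by
    change ψ v (disp v i g) = 0
    rw [h, hψ]))

/-- A letter from another vertex displaces no coset and merely permutes the terms. -/
theorem tsum_disp_of_mul_of_ne {v a : V} (ha : v ≠ a) (s : G a) (g : GraphProduct Γ G) :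
    ∑' i, ψ v (disp v i (of Γ G a s * g)) = ∑' i, ψ v (disp v i g) := by
  rw [← (MulAction.toPerm (of Γ G a s)⁻¹).tsum_eq fun i => ψ v (disp v i g)]
  refine tsum_congr fun i => ?_
  have h := displacement_mul firstSyllable_one i (of Γ G a s) g
  have h' : displacement firstSyllable_one i (of Γ G a s) = 1 := disp_of_of_ne ha i s
  rw [h', one_mul] at h
  rw [disp, h]
  rfl

/-- Translation by s fixes the base coset, where the displacement goes from 1 to s, and permutes the
other terms. -/
theorem tsum_disp_of_mul (hψ : ∀ a, ψ a 1 = 0) {v : V} (s : G v) {g : GraphProduct Γ G}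
    (hg : firstSyllable Γ G v g = 1) :
    ∑' i, ψ v (disp v i (of Γ G v s * g)) = ψ v s + ∑' i, ψ v (disp v i g) := by
  have h : ∀ i, disp v i (of Γ G v s * g) =
      disp v i (of Γ G v s) * disp v ((of Γ G v s)⁻¹ • i) g := fun i =>
    displacement_mul firstSyllable_one i (of Γ G v s) g
  refine tsum_eq_add_tsum_of_perm (summable_disp hψ v g) (MulAction.toPerm (of Γ G v s)⁻¹)
    (c := ((1 : GraphProduct Γ G) : GraphProduct Γ G ⧸ star Γ G v)) (fun i hi => ?_) ?_ ?_
  · rw [h, disp_of hi, one_mul]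
    rfl
  · rw [MulAction.toPerm_apply, of_inv_smul_one, disp_one, hg, hψ]
  · rw [disp_one, firstSyllable_of_mul, hg, mul_one]

theorem le_tsum_disp [Fintype V] (hψ : ∀ a, ψ a 1 = 0) {ℓ : GraphProduct Γ G → ℝ} (h1 : ℓ 1 ≤ 0)
    (hℓ : ∀ a s g, ℓ (of Γ G a s * g) ≤ ψ a s + ℓ g) (g : GraphProduct Γ G) :
    ℓ g ≤ ∑ v, ∑' i, ψ v (disp v i g) := by
  classical
  obtain ⟨l, rfl⟩ := exists_syllableProd g
  obtain ⟨n, hn⟩ : ∃ n, l.length ≤ n := ⟨_, le_rfl⟩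
  induction n generalizing l with
  | zero =>
    obtain rfl : l = [] := by simpa using hn
    refine h1.trans (le_of_eq ?_)
    simp [syllableProd, disp, displacement, hψ]
  | succ n ih =>
    rcases l with _ | ⟨⟨v, s⟩, l⟩
    · exact ih [] (by simp)
    have hn' : l.length ≤ n := by simpa using hn
    by_cases hv : firstSyllable Γ G v (syllableProd l) = 1
    · rw [syllableProd_cons]
      refine (hℓ v s _).trans ((add_le_add_right (ih l hn') _).trans (le_of_eq ?_))
      rw [← Finset.add_sum_erase _ _ (Finset.mem_univ v),
        ← Finset.add_sum_erase _ _ (Finset.mem_univ v), tsum_disp_of_mul hψ s hv, add_assoc]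
      congr 2
      exact Finset.sum_congr rfl fun a ha =>
        (tsum_disp_of_mul_of_ne (Finset.ne_of_mem_erase ha) s _).symm
    -- If the tail has a nontrivial first syllable at v, merging it with s gives an expression with
    -- fewer syllables.
    · obtain ⟨l', hlt, h⟩ := exists_shorter l hv
      have : syllableProd (⟨v, s⟩ :: l) = syllableProd (Γ := Γ)
          (⟨v, s * firstSyllable Γ G v (syllableProd l)⟩ :: l') := by
        rw [syllableProd_cons, syllableProd_cons, map_mul, mul_assoc, ← h]
      rw [this]
      refine ih _ ?_
      simp only [List.length_cons]
      omega

end Length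

end GraphProduct

/-! ### Word length. -/

section WordLength

variable {G : Type*} [Group G] {S : Set G}

theorem exists_list_length_eq_wordLength (hS : Subgroup.closure S = ⊤) (g : G) :
    ∃ l : List G, l.length = wordLength S g ∧ (∀ x ∈ l, x ∈ S ∨ x⁻¹ ∈ S) ∧ l.prod = g := by
  refine Nat.sInf_mem (s := {n | ∃ l : List G, l.length = n ∧ (∀ x ∈ l, x ∈ S ∨ x⁻¹ ∈ S) ∧
    l.prod = g}) ?_
  have hg : g ∈ Submonoid.closure (S ∪ S⁻¹) := by
    rw [← Subgroup.closure_toSubmonoid, hS]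
    trivial
  obtain ⟨l, hl, h⟩ := Submonoid.exists_list_of_mem_closure hg
  exact ⟨_, l, rfl, hl, h⟩

theorem wordLength_prod_le {l : List G} (hl : ∀ x ∈ l, x ∈ S ∨ x⁻¹ ∈ S) :
    wordLength S l.prod ≤ l.length :=
  Nat.sInf_le ⟨l, rfl, hl, rfl⟩

theorem wordLength_one : wordLength S (1 : G) = 0 :=
  Nat.le_zero.1 (wordLength_prod_le (l := []) (by simp))

theorem wordLength_mul_le (hS : Subgroup.closure S = ⊤) (g h : G) :
    wordLength S (g * h) ≤ wordLength S g + wordLength S h := by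
  obtain ⟨l, hl, hl', rfl⟩ := exists_list_length_eq_wordLength hS g
  obtain ⟨m, hm, hm', rfl⟩ := exists_list_length_eq_wordLength hS h
  rw [← List.prod_append, ← hl, ← hm, ← List.length_append]
  refine wordLength_prod_le fun x hx => ?_
  exact (List.mem_append.1 hx).elim (hl' x) (hm' x)

/-- A subadditive function on a finitely generated group is bounded by a multiple of the word
length. -/
theorem exists_le_mul_wordLength (hfin : S.Finite) (hS : Subgroup.closure S = ⊤) {ℓ : G → ℝ}
    (h1 : ℓ 1 ≤ 0) (hℓ : ∀ g h, ℓ (g * h) ≤ ℓ g + ℓ h) :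
    ∃ M > 0, ∀ g, ℓ g ≤ M * wordLength S g := by
  obtain ⟨M, hM⟩ := ((hfin.union hfin.inv).image ℓ).bddAbove
  refine ⟨max M 1, by positivity, fun g => ?_⟩
  obtain ⟨l, hl, hl', rfl⟩ := exists_list_length_eq_wordLength hS g
  rw [← hl]
  clear hl
  induction l with
  | nil => simpa using h1
  | cons x l ih =>
    have hx : ℓ x ≤ max M 1 :=
      (hM ⟨x, hl' x List.mem_cons_self, rfl⟩).trans (le_max_left _ _)
    have := ih fun y hy => hl' y (List.mem_cons_of_mem _ hy)
    rw [List.prod_cons, List.length_cons]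
    push_cast
    linarith [hℓ x l.prod]

theorem countable_of_closure_eq_top (hfin : S.Finite) (hS : Subgroup.closure S = ⊤) :
    Countable G := by
  have : Countable ↥(S ∪ S⁻¹) := (hfin.union hfin.inv).countable.to_subtype
  refine Function.Surjective.countable (f := fun l : List ↥(S ∪ S⁻¹) => (l.map (↑)).prod) fun g => ?_
  obtain ⟨l, -, hl, rfl⟩ := exists_list_length_eq_wordLength hS g
  lift l to List ↥(S ∪ S⁻¹) using hl
  exact ⟨l, rfl⟩

end WordLength

/-! ### Compression in terms of cocycles. -/

section Compression

variable {𝕜 : Type k} [RCLike 𝕜] {p : ℝ≥0∞} [hp1 : Fact (1 ≤ p)] {H : Type u} [Group H] {S : Set H}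

theorem bddAbove_compression_set {E : Type*} [NormedAddCommGroup E] (f : H → E) :
    BddAbove {r : ℝ | 0 ≤ r ∧ r ≤ 1 ∧ ∃ C D : ℝ, 0 < C ∧ 0 < D ∧ ∀ g h : H,
      1 / C * (wordDist S g h : ℝ) ^ r - D ≤ ‖f g - f h‖ ∧ ‖f g - f h‖ ≤ C * wordDist S g h} :=
  ⟨1, fun _ hr => hr.2.1⟩

theorem compression_le_one {E : Type*} [NormedAddCommGroup E] (f : H → E) :
    compression S f ≤ 1 :=
  Real.sSup_le (fun _ hr => hr.2.1) zero_le_one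

theorem compression_nonneg {E : Type*} [NormedAddCommGroup E] (f : H → E) :
    0 ≤ compression S f :=
  Real.sSup_nonneg fun _ hr => hr.1

theorem equivariantCompression_nonneg : 0 ≤ equivariantCompression.{w} 𝕜 p S := by
  refine Real.sSup_nonneg ?_
  rintro _ ⟨Ω, _, μ, f, -, -, rfl⟩
  exact compression_nonneg f

/-- A cocycle whose norm grows at least like the `r`-th power of the word length witnesses that
the equivariant compression is at least `r`. -/
theorem IsLpLength.le_equivariantCompression (hp : p ≠ ∞) (hfin : S.Finite)
    (hS : Subgroup.closure S = ⊤) {r c : ℝ} (hr0 : 0 < r) (hr1 : r ≤ 1) (hc : 0 < c) {ψ : H → ℝ}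
    (hψ : IsLpLength.{w} 𝕜 p ψ) (h : ∀ g, c * (wordLength S g : ℝ) ^ (r * p.toReal) ≤ ψ g) :
    r ≤ equivariantCompression.{w} 𝕜 p S := by
  obtain ⟨Ω, _, μ, π, b, hb, hψb⟩ := hψ
  have hpos := ENNReal.toReal_pos (zero_lt_one.trans_le hp1.out).ne' hp
  obtain ⟨M, hM0, hM⟩ := exists_le_mul_wordLength hfin hS (ℓ := fun g => ‖b g‖)
    (by simp [hb.map_one]) fun g h => by
      rw [hb g h]
      exact (norm_add_le _ _).trans (by rw [LinearIsometryEquiv.norm_map])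
  have hnorm : ∀ g h, ‖b g - b h‖ = ‖b (g⁻¹ * h)‖ := fun g h => by
    rw [norm_sub_rev, hb.norm_sub]
  obtain ⟨a, ha0, ha⟩ : ∃ a > 0, ∀ g, a * (wordLength S g : ℝ) ^ r ≤ ‖b g‖ := by
    refine ⟨c ^ p.toReal⁻¹, by positivity, fun g => ?_⟩
    rw [← Real.rpow_le_rpow_iff (by positivity) (norm_nonneg _) hpos, ← hψb,
      Real.mul_rpow (by positivity) (by positivity), Real.rpow_inv_rpow hc.le hpos.ne',
      ← Real.rpow_mul (by positivity)]
    exact h g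
  have hmem : compression S b ∈ {x : ℝ | ∃ (Ω : Type w) (_ : MeasurableSpace Ω) (μ : Measure Ω)
      (f : H → Lp 𝕜 p μ), IsCoarseEmbedding S f ∧ IsAffineEquivariant 𝕜 f ∧
        x = compression S f} := by
    refine ⟨Ω, _, μ, b, ⟨fun t => a.toNNReal * t ^ r, M, ?_, ?_, hM0, fun g h => ⟨?_, ?_⟩⟩,
      hb.isAffineEquivariant, rfl⟩
    · intro s t hst
      exact mul_le_mul_right (NNReal.rpow_le_rpow hst hr0.le) _
    · exact (NNReal.tendsto_rpow_atTop hr0).const_mul_atTop (Real.toNNReal_pos.2 ha0)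
    · rw [hnorm]
      rw [NNReal.coe_mul, NNReal.coe_rpow, NNReal.coe_natCast, Real.coe_toNNReal a ha0.le]
      exact ha (g⁻¹ * h)
    · rw [hnorm]
      exact hM _
  refine le_trans ?_ (le_csSup ⟨1, ?_⟩ hmem)
  · refine le_csSup (bddAbove_compression_set b) ⟨hr0.le, hr1, max a⁻¹ M, 1, by positivity,
      one_pos, fun g h => ⟨?_, ?_⟩⟩
    · rw [hnorm, wordDist]
      refine le_trans ?_ (ha (g⁻¹ * h))
      have : 1 / max a⁻¹ M ≤ a := by
        rw [one_div]
        exact inv_le_of_inv_le₀ ha0 (le_max_left _ _)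
      have := mul_le_mul_of_nonneg_right this
        (Real.rpow_nonneg (Nat.cast_nonneg (wordLength S (g⁻¹ * h))) r)
      linarith
    · rw [hnorm, wordDist]
      exact (hM _).trans (by gcongr; exact le_max_right _ _)
  · rintro _ ⟨Ω, _, μ, f, -, -, rfl⟩
    exact compression_le_one f

/-- Below the equivariant compression, there are cocycles whose norm grows like the corresponding
power of the word length. -/
theorem exists_isLpLength_of_lt_equivariantCompression (hp : p ≠ ∞) (hfin : S.Finite)
    (hS : Subgroup.closure S = ⊤) {r : ℝ} (hr0 : 0 < r)
    (hr : r < equivariantCompression.{w} 𝕜 p S) :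
    ∃ ψ : H → ℝ, IsLpLength.{w} 𝕜 p ψ ∧ ∃ c > 0, ∀ g,
      c * (wordLength S g : ℝ) ^ (r * p.toReal) ≤ ψ g := by
  have hpos := ENNReal.toReal_pos (zero_lt_one.trans_le hp1.out).ne' hp
  have : Countable H := countable_of_closure_eq_top hfin hS
  -- An empty supremum is 0, so r > 0 makes this set, and the next one, nonempty.
  obtain ⟨_, ⟨Ω, _, μ, f, -, ⟨α, hα⟩, rfl⟩, hrf⟩ : ∃ x ∈ _, r < x := by
    refine exists_lt_of_lt_csSup ?_ hr
    by_contra hne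
    rw [equivariantCompression, Set.not_nonempty_iff_eq_empty.1 hne, Real.sSup_empty] at hr
    exact hr0.not_gt hr
  obtain ⟨r', ⟨-, -, C, D, hC, hD, hCD⟩, hrr'⟩ : ∃ x ∈ _, r < x := by
    refine exists_lt_of_lt_csSup ?_ hrf
    by_contra hne
    rw [compression, Set.not_nonempty_iff_eq_empty.1 hne, Real.sSup_empty] at hrf
    exact hr0.not_gt hrf
  have hb := IsIsometryCocycle.of_equivariant hα
  have hlow : ∀ g, 1 / C * (wordLength S g : ℝ) ^ r - D ≤ ‖f g - f 1‖ := fun g => by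
    have h := (hCD 1 g).1
    rw [wordDist, inv_one, one_mul, norm_sub_rev] at h
    refine le_trans ?_ h
    gcongr 1 / C * ?_ - D
    rcases Nat.eq_zero_or_pos (wordLength S g) with h0 | h0
    · rw [h0, Nat.cast_zero, Real.zero_rpow hr0.ne', Real.zero_rpow (hr0.trans hrr').ne']
    · exact Real.rpow_le_rpow_of_exponent_le (by exact_mod_cast h0) hrr'.le
  obtain ⟨δ, hδ, hδ1⟩ := exists_isLpLength_one_le.{w} (𝕜 := 𝕜) (H := H) hp
  have hψ₁ : IsLpLength.{w} 𝕜 p fun g => ‖f g - f 1‖ ^ p.toReal := ⟨Ω, _, μ, _, _, hb, fun g => rfl⟩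
  -- If |g|^r ≥ 2CD, then D is at most half of |g|^r / C, leaving the factor 1/(2C). Otherwise |g|^r
  -- / (2CD) ≤ 1, which `δ` dominates.
  refine ⟨_, hψ₁.add hp hδ, min ((1 / (2 * C)) ^ p.toReal) ((1 / (2 * C * D)) ^ p.toReal),
    by positivity, fun g => ?_⟩
  by_cases hg : g = 1
  · rw [hg, wordLength_one, Nat.cast_zero, Real.zero_rpow (by positivity), mul_zero]
    exact add_nonneg (hψ₁.nonneg 1) (hδ.nonneg 1)
  rw [Real.rpow_mul (by positivity)]
  set t := (wordLength S g : ℝ) ^ r with ht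
  have ht0 : 0 ≤ t := by positivity
  have hψg := hψ₁.nonneg g
  have hδg := hδ.nonneg g
  rcases le_total (2 * C * D) t with hle | hle
  · have h1 : 1 / (2 * C) * t ≤ ‖f g - f 1‖ := by
      refine le_trans ?_ (hlow g)
      rw [← ht]
      have : D ≤ 1 / (2 * C) * t := by
        rw [one_div, ← div_eq_inv_mul, le_div_iff₀ (by positivity)]
        linarith
      have h2 : 1 / C * t = 1 / (2 * C) * t + 1 / (2 * C) * t := by
        field_simp
        ring
      linarith
    calc _ ≤ (1 / (2 * C)) ^ p.toReal * t ^ p.toReal := by gcongr; exact min_le_left _ _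
      _ = (1 / (2 * C) * t) ^ p.toReal := (Real.mul_rpow (by positivity) ht0).symm
      _ ≤ ‖f g - f 1‖ ^ p.toReal := by gcongr
      _ ≤ _ := by linarith
  · calc _ ≤ (1 / (2 * C * D)) ^ p.toReal * t ^ p.toReal := by gcongr; exact min_le_right _ _
      _ = (1 / (2 * C * D) * t) ^ p.toReal := (Real.mul_rpow (by positivity) ht0).symm
      _ ≤ 1 := by
        refine Real.rpow_le_one (by positivity) ?_ hpos.le
        rw [one_div, ← div_eq_inv_mul]
        exact div_le_one_of_le₀ hle (by positivity)
      _ ≤ _ := by linarith [hδ1 g hg]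

end Compression

/-! ### The compression of graph products. -/

theorem corollary4p3 (𝕜 : Type k) [RCLike 𝕜] (p : ℝ≥0∞) [Fact (1 ≤ p)] (hp : p ≠ ∞)
    {V : Type v} [Finite V] (Γ : SimpleGraph V) (G : V → Type u) [∀ a, Group (G a)]
    (S : ∀ a, Set (G a)) (hSfin : ∀ a, (S a).Finite)
    (hSgen : ∀ a, Subgroup.closure (S a) = ⊤) :
    Group.FG (GraphProduct Γ G) ∧
    ∀ T : Set (GraphProduct Γ G), T.Finite → Subgroup.closure T = ⊤ →
      equivariantCompression.{w} 𝕜 p T ≥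
        sInf (insert (1 / p.toReal)
          (Set.range fun a => equivariantCompression.{w} 𝕜 p (S a))) := by
  have hp1 : (1 : ℝ) ≤ p.toReal := by
    simpa using ENNReal.toReal_mono hp (Fact.out : 1 ≤ p)
  refine ⟨Group.fg_iff.2 ⟨⋃ a, GraphProduct.of Γ G a '' S a, ?_,
    Set.finite_iUnion fun a => (hSfin a).image _⟩, fun T hTfin hT => ?_⟩
  · rw [eq_top_iff, ← Subgroup.toSubmonoid_le, Subgroup.top_toSubmonoid,
      ← GraphProduct.closure_iUnion_range_of, Submonoid.closure_le]
    rintro x hx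
    obtain ⟨a, s, rfl⟩ := Set.mem_iUnion.1 hx
    have : (Subgroup.closure (S a)).map (GraphProduct.of Γ G a) ≤
        Subgroup.closure (⋃ a, GraphProduct.of Γ G a '' S a) := by
      rw [MonoidHom.map_closure]
      exact Subgroup.closure_mono (Set.subset_iUnion (fun a => GraphProduct.of Γ G a '' S a) a)
    refine this ⟨s, ?_, rfl⟩
    rw [hSgen]
    trivial
  have := Fintype.ofFinite V
  have hbdd : BddBelow (insert (1 / p.toReal)
      (Set.range fun a => equivariantCompression.{w} 𝕜 p (S a))) :=
    ((Set.finite_range _).insert _).bddBelow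
  refine le_of_forall_lt_imp_le_of_dense fun r hr => ?_
  rcases le_or_gt r 0 with hr0 | hr0
  · exact hr0.trans equivariantCompression_nonneg
  have hrp : r ≤ 1 / p.toReal := (hr.trans_le (csInf_le hbdd (Set.mem_insert _ _))).le
  have hq0 : 0 ≤ r * p.toReal := by positivity
  have hq1 : r * p.toReal ≤ 1 := (le_div_iff₀ (by positivity)).1 hrp
  have hr1 : r ≤ 1 := hrp.trans (by rw [one_div]; exact inv_le_one_of_one_le₀ hp1)
  have hSr : ∀ a, r < equivariantCompression.{w} 𝕜 p (S a) := fun a =>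
    hr.trans_le (csInf_le hbdd (Set.mem_insert_of_mem _ ⟨a, rfl⟩))
  choose ψ hψ d hd0 hd using fun a =>
    exists_isLpLength_of_lt_equivariantCompression hp (hSfin a) (hSgen a) hr0 (hSr a)
  -- `M a` is a Lipschitz constant of the inclusion of G a for the word lengths of `S a` and `T`.
  choose M hM0 hM using fun a => exists_le_mul_wordLength (hSfin a) (hSgen a)
    (ℓ := fun s => (wordLength T (GraphProduct.of Γ G a s) : ℝ))
    (by simp [wordLength_one]) fun g h => by
      rw [map_mul]
      exact_mod_cast wordLength_mul_le hT _ _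
  -- Taking c close to 0 rather than a minimum over vertices also covers the empty graph.
  obtain ⟨c, hc, hc0⟩ : ∃ c : ℝ, (∀ a, c ≤ d a / M a ^ (r * p.toReal)) ∧ 0 < c := by
    have h : ∀ᶠ c in nhdsWithin (0 : ℝ) (Set.Ioi 0), ∀ a, c ≤ d a / M a ^ (r * p.toReal) := by
      refine eventually_all.2 fun a => ?_
      have : 0 < d a / M a ^ (r * p.toReal) :=
        div_pos (hd0 a) (Real.rpow_pos_of_pos (hM0 a) _)
      filter_upwards [Ioo_mem_nhdsGT this] with c hc using hc.2.le
    exact (h.and self_mem_nhdsWithin).exists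
  have : Countable (GraphProduct Γ G) := countable_of_closure_eq_top hTfin hT
  have hΨ : IsLpLength.{w} 𝕜 p fun g : GraphProduct Γ G =>
      ∑ a, ∑' i, ψ a (GraphProduct.disp a i g) :=
    IsLpLength.sum hp fun a => IsLpLength.induced GraphProduct.firstSyllable_one hp (hψ a)
      GraphProduct.finite_disp_ne_one
  refine hΨ.le_equivariantCompression hp hTfin hT hr0 hr1 hc0 fun g => ?_
  refine GraphProduct.le_tsum_disp (fun a => (hψ a).map_one hp)
    (ℓ := fun g => c * (wordLength T g : ℝ) ^ (r * p.toReal)) ?_ (fun a s g => ?_) g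
  · have : r * p.toReal ≠ 0 := by positivity
    simp [wordLength_one, Real.zero_rpow this]
  have hs : c * (wordLength T (GraphProduct.of Γ G a s) : ℝ) ^ (r * p.toReal) ≤ ψ a s := by
    refine le_trans ?_ (hd a s)
    have hMq := Real.rpow_pos_of_pos (hM0 a) (r * p.toReal)
    calc c * (wordLength T (GraphProduct.of Γ G a s) : ℝ) ^ (r * p.toReal)
        ≤ c * (M a * wordLength (S a) s) ^ (r * p.toReal) := by
          gcongr
          exact hM a s
      _ = c * M a ^ (r * p.toReal) * (wordLength (S a) s : ℝ) ^ (r * p.toReal) := by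
          rw [Real.mul_rpow (hM0 a).le (by positivity), mul_assoc]
      _ ≤ _ := by
          gcongr
          exact (le_div_iff₀ hMq).1 (hc a)
  calc c * (wordLength T (GraphProduct.of Γ G a s * g) : ℝ) ^ (r * p.toReal)
      ≤ c * ((wordLength T (GraphProduct.of Γ G a s) : ℝ) + wordLength T g) ^ (r * p.toReal) := by
        gcongr
        exact_mod_cast wordLength_mul_le hT _ _
    _ ≤ c * ((wordLength T (GraphProduct.of Γ G a s) : ℝ) ^ (r * p.toReal) +
          (wordLength T g : ℝ) ^ (r * p.toReal)) := by
        gcongr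
        exact Real.rpow_add_le_add_rpow (by positivity) (by positivity) hq0 hq1
    _ ≤ _ := by
        rw [mul_add]
        gcongr
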